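/- Let $\mathcal I_n$ be the set of inversion sequences of length $n$, i.e. integer sequences $(\sigma_1,\dots,\sigma_n)$ with $0\le\sigma_i\le i-1$. For $n,m\ge 0$ let $\mathcal A_{n,m}$ be the set of $\sigma\in\mathcal I_n$ together with a colouring of the values $0,\dots,n-1$ (whether or not they occur in $\sigma$) by blue and red, with $m$ blue values and $n-m$ red values, such that every red value occurs at least twice in $\sigma$. For $n,m\ge 1$ let $\mathcal B_{n,m}$ be the set of rooted non-plane trees on $n$ nodes, labelled bijectively by $0,\dots,n-1$ so that each non-root node has a greater label than its parent, with $m$ nodes coloured blue and $n-m$ coloured red, such that every red node has at least two children. (Both sets are empty if $n<m$.) Let $$B(x,y)=\sum_{n,m\ge1}\frac{|\mathcal B_{n,m}|}{n!}\,x^ny^m .$$ 1. As formal power series, $$\frac{\partial B}{\partial x}(x,y)=(y+1)e^{B(x,y)}-B(x,y)-1,\qquad B(0,y)=0 .$$ 2. For $\sigma\in\mathcal A_{n,m}$ let $\phi(\sigma)$ be the coloured tree with nodes $0,\dots,n$ and root $0$ in which the children of node $v$ are the positions (in $\{1,\dots,n\}$) of the value $v$ in $\sigma$, each node $v<n$ has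 the colour of the value $v$, and node $n$ is blue. Then, for all $n,m\ge 0$, $\phi$ is a bijection from $\mathcal A_{n,m}$ onto $\mathcal B_{n+1,m+1}$. 3. A Cayley permutation is a finite sequence whose set of values is $\{0,\dots,M\}$ for some $M$ (or empty); a sequence contains $\rho$ if it has a subsequence order-isomorphic to $\rho$. For a nonempty Cayley permutation $\rho$, a $\rho$-minimal inversion sequence is a minimal element, for pattern containment, of the set of all inversion sequences (of any length) that are Cayley permutations and contain $\rho$. Let $\rho=(\rho_1,\dots,\rho_k)$, $k\ge1$, be a Cayley permutation with $\rho_1=\mathbf{mdd}(\rho)=m$, where $\mathbf{mdd}(\rho)=\max_{1\le i\le k}(\rho_i-i+1)$. Then, for every $n\ge0$, the number of $\rho$-minimal inversion sequences of length $n+k$ is $$|\mathcal A_{n,m}|=|\mathcal B_{n+1,m+1}|=(n+1)!\,[x^{n+1}y^{m+1}]B(x,y),$$ and there are finitely many $\rho$-minimal inversion sequences in total, namely $\sum_{n=m}^{2m}|\mathcal A_{n,m}|$. -/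

import Mathlib

open scoped Nat PowerSeries

namespace InvSeq

/-! Sequences are functions on `Fin n`, so positions are numbered from `0`: the entry at
`i : Fin n` is the `(i + 1)`-st entry of the sequence. -/

/-- Inversion sequences: the `(i + 1)`-st entry lies in `{0, …, i}`. -/
def IsInvSeq {n : ℕ} (σ : Fin n → ℕ) : Prop :=
  ∀ i : Fin n, σ i ≤ (i : ℕ)

/-- Cayley permutations: the set of values is an initial segment `{0, …, max}` of `ℕ`. -/
def IsCayley {n : ℕ} (σ : Fin n → ℕ) : Prop :=
  ∀ i : Fin n, Set.Iic (σ i) ⊆ Set.range σ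

/-- `Contains ρ σ`: some subsequence of `σ` is order-isomorphic to `ρ`
(`σ` contains the pattern `ρ`, written `ρ ≼ σ`). -/
def Contains {k n : ℕ} (ρ : Fin k → ℕ) (σ : Fin n → ℕ) : Prop :=
  ∃ f : Fin k → Fin n, StrictMono f ∧ ∀ i j : Fin k, ρ i < ρ j ↔ σ (f i) < σ (f j)

/-- Members of `IP[ρ]`: inversion sequences that are Cayley permutations and contain `ρ`. -/
def InIP {k n : ℕ} (ρ : Fin k → ℕ) (σ : Fin n → ℕ) : Prop :=
  IsInvSeq σ ∧ IsCayley σ ∧ Contains ρ σ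

/-- `σ` is a `ρ`-minimal inversion sequence: a minimal element of `IP[ρ]` (whose members have
arbitrary lengths) for pattern containment. -/
def IsMinimalFor {k n : ℕ} (ρ : Fin k → ℕ) (σ : Fin n → ℕ) : Prop :=
  InIP ρ σ ∧ ∀ (l : ℕ) (τ : Fin l → ℕ), InIP ρ τ → Contains τ σ → Contains σ τ

/-- The maximum diagonal difference: the maximum of `σ_i - i + 1` over `i = 1, …, n`, that is,
of `σ i - i` with positions numbered from `0`. -/
def mdd {n : ℕ} [NeZero n] (σ : Fin n → ℕ) : ℤ :=
  Finset.univ.sup' ⟨0, Finset.mem_univ _⟩ fun i : Fin n => (σ i : ℤ) - ((i : ℕ) : ℤ)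

inductive Colour : Type
  | blue
  | red

/-- An inversion sequence of length `n` together with a colour for each value in `[0, n - 1]`. -/
@[ext]
structure ColouredInvSeq (n : ℕ) where
  val : Fin n → ℕ
  isInvSeq : IsInvSeq val
  colour : Fin n → Colour

/-- The set `A_{n,m}`: there are `m` blue and `n - m` red values in `[0, n - 1]`, and each red
value occurs at least twice. -/
def setA (n m : ℕ) : Set (ColouredInvSeq n) :=
  {s | {v | s.colour v = Colour.blue}.ncard = m ∧
    {v | s.colour v = Colour.red}.ncard = n - m ∧
    ∀ v : Fin n, s.colour v = Colour.red → 2 ≤ {i : Fin n | s.val i = (v : ℕ)}.ncard}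

/-- A rooted, non-plane tree whose nodes are labelled bijectively by `[0, n - 1]`, given by its
root and its parent function (with the convention that the parent of the root is the root). -/
@[ext]
structure RootedTree (n : ℕ) where
  root : Fin n
  parent : Fin n → Fin n
  parent_root : parent root = root
  reaches_root : ∀ v : Fin n, ∃ j : ℕ, parent^[j] v = root

/-- The set of children of a node. -/
def RootedTree.children {n : ℕ} (T : RootedTree n) (v : Fin n) : Set (Fin n) :=
  {w | w ≠ T.root ∧ T.parent w = v}

/-- Increasing trees: each non-root node has a greater label than its parent. -/
def RootedTree.IsIncreasing {n : ℕ} (T : RootedTree n) : Prop :=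
  ∀ v : Fin n, v ≠ T.root → T.parent v < v

@[ext]
structure ColouredTree (n : ℕ) where
  tree : RootedTree n
  colour : Fin n → Colour

/-- The set `B_{n,m}`: coloured increasing trees on `n` nodes with `m` blue nodes and `n - m` red
nodes, such that each red node has at least two children. -/
def setB (n m : ℕ) : Set (ColouredTree n) :=
  {t | t.tree.IsIncreasing ∧
    {v | t.colour v = Colour.blue}.ncard = m ∧
    {v | t.colour v = Colour.red}.ncard = n - m ∧
    ∀ v : Fin n, t.colour v = Colour.red → 2 ≤ (t.tree.children v).ncard}

/-- The parent function on `[0, n]` sending `0` to `0` and the label `i + 1` to the `(i + 1)`-st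
entry of `σ`. -/
def phiParent {n : ℕ} (σ : Fin n → ℕ) (h : IsInvSeq σ) : Fin (n + 1) → Fin (n + 1) :=
  Fin.cons 0 fun i : Fin n => ⟨σ i, (h i).trans_lt (i.isLt.trans (Nat.lt_succ_self n))⟩

theorem phiParent_reaches {n : ℕ} (σ : Fin n → ℕ) (h : IsInvSeq σ) :
    ∀ (b : ℕ) (v : Fin (n + 1)), (v : ℕ) ≤ b → ∃ j : ℕ, (phiParent σ h)^[j] v = 0 := by
  intro b
  induction b with
  | zero =>
    intro v hv
    exact ⟨0, Fin.ext (Nat.le_zero.mp hv)⟩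
  | succ b ih =>
    intro v hv
    induction v using Fin.cases with
    | zero => exact ⟨0, rfl⟩
    | succ i =>
      have h1 : ((phiParent σ h i.succ : Fin (n + 1)) : ℕ) ≤ b := by
        have h2 := h i
        have h3 : (i : ℕ) + 1 ≤ b + 1 := by simpa using hv
        have h4 : ((phiParent σ h i.succ : Fin (n + 1)) : ℕ) = σ i := by simp [phiParent]
        omega
      obtain ⟨j, hj⟩ := ih _ h1
      exact ⟨j + 1, by rw [Function.iterate_succ_apply]; exact hj⟩

/-- The map `φ` from coloured inversion sequences of length `n` to coloured trees on `[0, n]`: the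
root is `0`, the children of `v` are the positions (numbered from `1`) of the value `v`, each
`v < n` keeps its colour, and `n` is blue. -/
def phi {n : ℕ} (s : ColouredInvSeq n) : ColouredTree (n + 1) where
  tree :=
    { root := 0
      parent := phiParent s.val s.isInvSeq
      parent_root := rfl
      reaches_root := fun v => phiParent_reaches s.val s.isInvSeq v v le_rfl }
  colour := Fin.snoc (α := fun _ => Colour) s.colour Colour.blue

/-- The generating function `B(x, y) = ∑_{n, m ≥ 1} |B_{n,m}| / n! * x ^ n * y ^ m`, as an element
of `ℚ⟦y⟧⟦x⟧`: the outer variable is `x`, and the inner variable is `y`. -/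
noncomputable def genB : ℚ⟦X⟧⟦X⟧ :=
  PowerSeries.mk fun n => PowerSeries.mk fun m =>
    if 1 ≤ n ∧ 1 ≤ m then ((setB n m).ncard : ℚ) / (n ! : ℚ) else 0

end InvSeq

/-! The differential equation. Let `E = exp B`, `P 0 = B' = (y + 1) E - B - 1`, `P 1 = (y + 1) E -
1`, and `P c = (y + 1) E` for `c ≥ 2`. Then `(P c)' = P (c + 1) * P 0`. Differentiating a product
over the nodes of an increasing tree therefore attaches a new leaf to each node in turn, so the
`n`-th derivative of `B'` is a sum over inversion sequences of products of `P c`, with `c` the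
number of children (`iterate_derivation_eq_sum`). At `x = 0` the weights become `y, y, y + 1, y + 1,
…`: blue is always allowed, red only from two children on. So the solution constructed from the
equation has the coefficients of `genB`; the passage from sequences to trees is `φ`.

The minimal sequences. They turn out to be the sequences of `IsSuffixExtension`: a prefix of length
`n` all of whose values are repeated, then a copy of `ρ` starting on the diagonal. Necessity: an
entry outside an occurrence of `ρ` can be deleted unless its value is repeated and a later entry
lies on the diagonal; counting missing values then forces the occurrence to be the suffix
(`occurrence_start_eq`). Sufficiency: extensions of different lengths do not contain one another
(`not_contains`), and every member of `IP[ρ]` contains a minimal one.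

An extension is coded by its prefix together with the set of values below `n` used by the suffix,
coloured blue. There are `m = ρ 0` of these, and the red values, absent from the suffix, must occur
at least twice in the prefix: this is `setA n m`. -/

namespace InvSeq

/-! ### Iterated derivations and increasing trees -/

theorem derivation_prod {R A ι : Type*} [CommRing R] [CommRing A] [Algebra R A] [DecidableEq ι]
    (D : Derivation R A A) (s : Finset ι) (f : ι → A) :
    D (∏ i ∈ s, f i) = ∑ i ∈ s, D (f i) * ∏ j ∈ s.erase i, f j := by
  induction s using Finset.induction_on with
  | empty => simp
  | insert a s ha ih =>
    rw [Finset.prod_insert ha, Finset.sum_insert ha, D.leibniz, ih, Finset.erase_insert ha,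
      smul_eq_mul, smul_eq_mul, mul_comm (D (f a)), add_comm, Finset.mul_sum]
    congr 1
    refine Finset.sum_congr rfl fun i hi => ?_
    have hia : a ≠ i := fun h => ha (h ▸ hi)
    rw [Finset.erase_insert_of_ne hia, Finset.prod_insert (fun h => ha (Finset.mem_of_mem_erase h))]
    ring

/-- Inversion sequences of length `n`, as a finite type. -/
abbrev InvFn (n : ℕ) : Type := (i : Fin n) → Fin (i.val + 1)

/-- The number of occurrences of the value `v`. -/
def mult {n : ℕ} (a : InvFn n) (v : ℕ) : ℕ := ∑ i, if (a i : ℕ) = v then 1 else 0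

theorem mult_snoc {n : ℕ} (a : InvFn n) (x : Fin (n + 1)) (v : ℕ) :
    mult (n := n + 1) (Fin.snoc (α := fun i : Fin (n + 1) => Fin (i.val + 1)) a x) v =
      mult a v + if (x : ℕ) = v then 1 else 0 := by
  rw [mult, Fin.sum_univ_castSucc, mult, Fin.snoc_last]
  simp only [Fin.snoc_castSucc]

theorem mult_of_le {n : ℕ} (a : InvFn n) {v : ℕ} (h : n ≤ v) : mult a v = 0 := by
  refine Finset.sum_eq_zero fun i _ => if_neg ?_
  have := (a i).isLt
  have := i.isLt
  omega

theorem sum_invFn_succ {M : Type*} [AddCommMonoid M] {n : ℕ} (g : InvFn (n + 1) → M) :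
    ∑ a, g a = ∑ a : InvFn n, ∑ x : Fin (n + 1),
      g (Fin.snoc (α := fun i : Fin (n + 1) => Fin (i.val + 1)) a x) := by
  rw [← (Fin.snocEquiv (fun i : Fin (n + 1) => Fin (i.val + 1))).sum_comp, Fintype.sum_prod_type,
    Finset.sum_comm]
  rfl

/-- Iterating a derivation with `D (P c) = P (c + 1) * P 0` enumerates increasing trees by the
numbers of children of their nodes. -/
theorem iterate_derivation_eq_sum {R A : Type*} [CommRing R] [CommRing A] [Algebra R A]
    (D : Derivation R A A) (P : ℕ → A) (hP : ∀ c, D (P c) = P (c + 1) * P 0) (n : ℕ) :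
    D^[n] (P 0) = ∑ a : InvFn n, ∏ v ∈ Finset.range (n + 1), P (mult a v) := by
  induction n with
  | zero => simp [mult]
  | succ n ih =>
    rw [Function.iterate_succ_apply', ih, map_sum, sum_invFn_succ]
    refine Finset.sum_congr rfl fun a _ => ?_
    -- The Leibniz term for node `x` corresponds to appending the entry `x`: node `x` gains a child,
    -- and the extra factor `P 0` belongs to the new leaf `n + 1`.
    rw [derivation_prod, Finset.sum_range]
    refine Finset.sum_congr rfl fun x _ => ?_
    rw [Finset.prod_range_succ, hP]
    simp only [mult_snoc]
    rw [mult_of_le a (v := n + 1) (by omega), if_neg (c := (x : ℕ) = n + 1) (by omega),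
      ← Finset.mul_prod_erase (Finset.range (n + 1)) _ (Finset.mem_range.2 x.isLt), if_pos rfl]
    have : ∀ v ∈ (Finset.range (n + 1)).erase (x : ℕ),
        P (mult a v + if (x : ℕ) = v then 1 else 0) = P (mult a v) := fun v hv => by
      rw [if_neg (Finset.ne_of_mem_erase hv).symm, add_zero]
    rw [Finset.prod_congr rfl this]
    ring

/-! ### Formal solution of the differential equation -/

section Solution

variable {A : Type*} [CommRing A]

/-- Coefficients of the solution `(B, E)` of `B' = (y + 1) E - B - 1`, `E' = E B'`. -/
noncomputable def solCoeff [Algebra ℚ A] (y : A) : ℕ → A × A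
  | 0 => (0, 1)
  | n + 1 =>
    (algebraMap ℚ A (1 / (n + 1)) *
        ((y + 1) * (solCoeff y n).2 - (solCoeff y n).1 - if n = 0 then 1 else 0),
      algebraMap ℚ A (1 / (n + 1)) * ∑ i : Fin (n + 1), (solCoeff y i.val).2 *
        ((y + 1) * (solCoeff y (n - i.val)).2 - (solCoeff y (n - i.val)).1 -
          if n - i.val = 0 then 1 else 0))
  termination_by n => n

theorem algebraMap_inv_succ_mul [Algebra ℚ A] (n : ℕ) (a : A) :
    algebraMap ℚ A (1 / (n + 1)) * a * ((n : A) + 1) = a := by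
  have h : ((n : A) + 1) = algebraMap ℚ A (n + 1) := by simp
  rw [h, mul_right_comm, ← map_mul, one_div, inv_mul_cancel₀ (by positivity), map_one, one_mul]

/-- With `exp B` replaced by an independent unknown `E`, the system is polynomial and determines its
coefficients recursively. That `E` is the exponential is recovered afterwards by uniqueness. -/
theorem exists_solution [Algebra ℚ A] (y : A) : ∃ B E : A⟦X⟧, PowerSeries.constantCoeff B = 0 ∧
    PowerSeries.constantCoeff E = 1 ∧
    PowerSeries.derivative A B = (PowerSeries.C y + 1) * E - B - 1 ∧
    PowerSeries.derivative A E = E * ((PowerSeries.C y + 1) * E - B - 1) := by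
  have key : ∀ n, PowerSeries.coeff n ((PowerSeries.C y + 1) *
      (PowerSeries.mk fun n => (solCoeff y n).2) - (PowerSeries.mk fun n => (solCoeff y n).1) - 1) =
      (y + 1) * (solCoeff y n).2 - (solCoeff y n).1 - if n = 0 then 1 else 0 := fun n => by
    rw [← map_one (PowerSeries.C (R := A)), ← map_add, map_sub, map_sub, PowerSeries.coeff_C_mul,
      PowerSeries.coeff_C, PowerSeries.coeff_mk, PowerSeries.coeff_mk]
  refine ⟨PowerSeries.mk fun n => (solCoeff y n).1, PowerSeries.mk fun n => (solCoeff y n).2,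
    ?_, ?_, ?_, ?_⟩
  · rw [← PowerSeries.coeff_zero_eq_constantCoeff_apply, PowerSeries.coeff_mk, solCoeff]
  · rw [← PowerSeries.coeff_zero_eq_constantCoeff_apply, PowerSeries.coeff_mk, solCoeff]
  · ext n
    rw [PowerSeries.coeff_derivative, PowerSeries.coeff_mk, key, solCoeff,
      algebraMap_inv_succ_mul]
  · ext n
    rw [PowerSeries.coeff_derivative, PowerSeries.coeff_mk, solCoeff,
      algebraMap_inv_succ_mul, PowerSeries.coeff_mul,
      Finset.Nat.sum_antidiagonal_eq_sum_range_succ_mk, Finset.sum_range]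
    refine Finset.sum_congr rfl fun i _ => ?_
    rw [key, PowerSeries.coeff_mk]

/-- In a homogeneous linear equation, `n + 1` times the coefficient of degree `n + 1` is a
combination of lower coefficients, all zero by induction. -/
theorem eq_zero_of_derivative_eq_mul [IsAddTorsionFree A] {H G : A⟦X⟧}
    (h0 : PowerSeries.constantCoeff H = 0) (hH : PowerSeries.derivative A H = H * G) : H = 0 := by
  ext n
  rw [map_zero]
  induction n using Nat.strong_induction_on with
  | _ n ih =>
    cases n with
    | zero => rwa [PowerSeries.coeff_zero_eq_constantCoeff_apply]
    | succ n =>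
      have h := congrArg (PowerSeries.coeff n) hH
      rw [PowerSeries.coeff_derivative, PowerSeries.coeff_mul, Finset.sum_eq_zero] at h
      · rw [← Nat.cast_succ, mul_comm, ← nsmul_eq_mul] at h
        exact (smul_eq_zero_iff_right (Nat.succ_ne_zero n)).1 h
      · intro p hp
        rw [ih p.1 (by have := Finset.HasAntidiagonal.mem_antidiagonal.1 hp; omega), zero_mul]

/-- The weight of a node with `c` children in the derivatives of the solution. -/
noncomputable def nodeSeries (y : A) (B E : A⟦X⟧) : ℕ → A⟦X⟧
  | 0 => (PowerSeries.C y + 1) * E - B - 1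
  | 1 => (PowerSeries.C y + 1) * E - 1
  | _ => (PowerSeries.C y + 1) * E

theorem derivative_nodeSeries (y : A) (B E : A⟦X⟧)
    (hB : PowerSeries.derivative A B = (PowerSeries.C y + 1) * E - B - 1)
    (hE : PowerSeries.derivative A E = E * ((PowerSeries.C y + 1) * E - B - 1)) (c : ℕ) :
    PowerSeries.derivative A (nodeSeries y B E c) =
      nodeSeries y B E (c + 1) * nodeSeries y B E 0 := by
  have hC : PowerSeries.derivative A ((PowerSeries.C y + 1) * E) =
      (PowerSeries.C y + 1) * E * ((PowerSeries.C y + 1) * E - B - 1) := by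
    rw [Derivation.leibniz, map_add, PowerSeries.derivative_C, PowerSeries.derivative_one, hE,
      smul_eq_mul, smul_eq_mul]
    ring
  match c with
  | 0 =>
    simp only [nodeSeries]
    rw [map_sub, map_sub, hC, hB, PowerSeries.derivative_one]
    ring
  | 1 =>
    simp only [nodeSeries]
    rw [map_sub, hC, PowerSeries.derivative_one]
    ring
  | c + 2 => simp only [nodeSeries]; rw [hC]

/-- The weight of a node with `c` children: `y` for a blue node, and `1` for a red node if it is allowed. -/
def nodeWeight (y : A) (c : ℕ) : A := y + if 2 ≤ c then 1 else 0

theorem constantCoeff_nodeSeries (y : A) {B E : A⟦X⟧} (hB : PowerSeries.constantCoeff B = 0)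
    (hE : PowerSeries.constantCoeff E = 1) (c : ℕ) :
    PowerSeries.constantCoeff (nodeSeries y B E c) = nodeWeight y c := by
  match c with
  | 0 => simp [nodeSeries, nodeWeight, hB, hE]
  | 1 => simp [nodeSeries, nodeWeight, hE]
  | c + 2 => simp [nodeSeries, nodeWeight, hE]

theorem exists_exp_solution [Algebra ℚ A] (y : A) : ∃ B : A⟦X⟧,
    PowerSeries.constantCoeff B = 0 ∧
    PowerSeries.derivative A B =
      (PowerSeries.C y + 1) * (PowerSeries.exp A).subst B - B - 1 ∧
    ∀ n : ℕ, ((n + 1)! : A) * PowerSeries.coeff (n + 1) B =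
      ∑ a : InvFn n, ∏ v ∈ Finset.range (n + 1), nodeWeight y (mult a v) := by
  have : IsAddTorsionFree A := .of_module_rat A
  obtain ⟨B, E, hB0, hE0, hB, hE⟩ := exists_solution y
  have hs : PowerSeries.HasSubst B := PowerSeries.HasSubst.of_constantCoeff_zero' hB0
  -- Both sides satisfy `H' = H * B'` and have constant term 1, so their difference vanishes.
  have hsub : (PowerSeries.exp A).subst B = E := by
    rw [← sub_eq_zero]
    refine eq_zero_of_derivative_eq_mul (G := PowerSeries.derivative A B) ?_ ?_
    · rw [map_sub, hE0, sub_eq_zero, ← PowerSeries.coeff_zero_eq_constantCoeff_apply,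
        PowerSeries.coeff_subst' hs, finsum_eq_single _ 0]
      · simp
      · intro n hn
        simp [hB0, hn]
    · rw [map_sub, PowerSeries.derivative_subst hs, PowerSeries.derivative_exp, hE, hB, sub_mul]
  refine ⟨B, hB0, by rw [hsub, hB], fun n => ?_⟩
  have h := iterate_derivation_eq_sum (PowerSeries.derivative A) (nodeSeries y B E)
    (derivative_nodeSeries y B E hB hE) n
  have h1 : nodeSeries y B E 0 = PowerSeries.derivative A B := hB.symm
  rw [h1, ← Function.iterate_succ_apply] at h
  have h2 := congrArg PowerSeries.constantCoeff h
  rw [PowerSeries.constantCoeff_iterate_derivative, map_sum] at h2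
  rw [h2]
  refine Finset.sum_congr rfl fun a _ => ?_
  rw [map_prod]
  exact Finset.prod_congr rfl fun v _ => constantCoeff_nodeSeries y hB0 hE0 _

end Solution

/-! ### The bijection `φ` -/

theorem Colour.eq_red_iff {c : Colour} : c = Colour.red ↔ c ≠ Colour.blue := by
  cases c <;> simp

theorem ncard_red {n : ℕ} (c : Fin n → Colour) :
    {v | c v = Colour.red}.ncard = n - {v | c v = Colour.blue}.ncard := by
  have h : {v | c v = Colour.red} = {v | c v = Colour.blue}ᶜ := by
    ext v
    exact Colour.eq_red_iff
  rw [h, Set.ncard_compl, Nat.card_eq_fintype_card, Fintype.card_fin]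

theorem ncard_red_of_ncard_blue {n m : ℕ} {c : Fin n → Colour}
    (h : {v | c v = Colour.blue}.ncard = m) : {v | c v = Colour.red}.ncard = n - m := by
  rw [ncard_red, h]

theorem blue_ncard_snoc {n : ℕ} (c : Fin n → Colour) :
    {v | Fin.snoc (α := fun _ => Colour) c Colour.blue v = Colour.blue}.ncard =
      {v | c v = Colour.blue}.ncard + 1 := by
  have h : {v | Fin.snoc (α := fun _ => Colour) c Colour.blue v = Colour.blue} =
      insert (Fin.last n) (Fin.castSucc '' {v | c v = Colour.blue}) := by
    ext v
    induction v using Fin.lastCases with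
    | last => simp
    | cast v => simp [Fin.castSucc_ne_last]
  rw [h, Set.ncard_insert_of_notMem, Set.ncard_image_of_injective _ (Fin.castSucc_injective n)]
  rintro ⟨v, -, hv⟩
  exact Fin.castSucc_ne_last v hv

theorem phi_children {n : ℕ} (s : ColouredInvSeq n) (v : Fin (n + 1)) :
    (phi s).tree.children v = Fin.succ '' {i : Fin n | s.val i = (v : ℕ)} := by
  ext w
  induction w using Fin.cases with
  | zero => simp [RootedTree.children, phi]
  | succ i =>
    rw [(Fin.succ_injective n).mem_set_image]
    exact (and_iff_right (Fin.succ_ne_zero i)).trans Fin.ext_iff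

theorem phi_children_ncard {n : ℕ} (s : ColouredInvSeq n) (v : Fin (n + 1)) :
    ((phi s).tree.children v).ncard = {i : Fin n | s.val i = (v : ℕ)}.ncard := by
  rw [phi_children, Set.ncard_image_of_injective _ (Fin.succ_injective n)]

theorem phi_injective (n : ℕ) : Function.Injective (phi (n := n)) := by
  intro s t h
  have hp : (phi s).tree.parent = (phi t).tree.parent := by rw [h]
  have hc : (phi s).colour = (phi t).colour := by rw [h]
  refine ColouredInvSeq.ext (funext fun i => ?_) (funext fun i => ?_)
  · have := congrArg Fin.val (congrFun hp i.succ)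
    simpa [phi, phiParent] using this
  · have := congrFun hc i.castSucc
    simpa [phi] using this

theorem mapsTo_phi (n m : ℕ) : Set.MapsTo phi (setA n m) (setB (n + 1) (m + 1)) := by
  rintro s ⟨hb, -, h2⟩
  have hblue : {v | (phi s).colour v = Colour.blue}.ncard = m + 1 := by
    rw [← hb]
    exact blue_ncard_snoc s.colour
  refine ⟨fun v hv => ?_, hblue, ncard_red_of_ncard_blue hblue, fun v hv => ?_⟩
  · induction v using Fin.cases with
    | zero => exact absurd rfl hv
    | succ i =>
      have := s.isInvSeq i
      simp only [phi, phiParent, Fin.cons_succ, Fin.lt_def, Fin.val_succ]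
      omega
  · rw [phi_children_ncard]
    induction v using Fin.lastCases with
    | last => simp [phi] at hv
    | cast v => exact h2 v (by simpa [phi] using hv)

theorem RootedTree.IsIncreasing.root_eq_zero {n : ℕ} {T : RootedTree (n + 1)}
    (h : T.IsIncreasing) : T.root = 0 := by
  by_contra hne
  exact absurd (h 0 (Ne.symm hne)) (Fin.not_lt_zero _)

theorem surjOn_phi (n m : ℕ) : Set.SurjOn phi (setA n m) (setB (n + 1) (m + 1)) := by
  rintro t ⟨hinc, hb, -, h2⟩
  have hroot := hinc.root_eq_zero
  have hlt : ∀ i : Fin n, (t.tree.parent i.succ : ℕ) < i + 1 := fun i =>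
    hinc i.succ (by rw [hroot]; exact Fin.succ_ne_zero i)
  let s : ColouredInvSeq n :=
    { val := fun i => t.tree.parent i.succ
      isInvSeq := fun i => Nat.lt_succ_iff.1 (hlt i)
      colour := fun v => t.colour v.castSucc }
  -- The largest label has no children, so it cannot be red. This is why `φ` may always colour it
  -- blue.
  have hlast : t.colour (Fin.last n) = Colour.blue := by
    by_contra hne
    have hempty : t.tree.children (Fin.last n) = ∅ := by
      refine Set.eq_empty_of_forall_notMem fun w hw => ?_
      have := hinc w hw.1
      rw [hw.2] at this
      exact absurd (Fin.le_last w) (not_le.2 this)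
    have := h2 _ (Colour.eq_red_iff.2 hne)
    rw [hempty, Set.ncard_empty] at this
    omega
  have hphi : phi s = t := by
    refine ColouredTree.ext (RootedTree.ext hroot.symm (funext fun v => ?_)) (funext fun v => ?_)
    · induction v using Fin.cases with
      | zero =>
        have := t.tree.parent_root
        rw [hroot] at this
        rw [this]
        rfl
      | succ i => exact Fin.ext (by simp [phi, phiParent, s])
    · induction v using Fin.lastCases with
      | last => simp [phi, hlast]
      | cast v => simp [phi, s]
  refine ⟨s, ?_, hphi⟩
  have hblue : {v | s.colour v = Colour.blue}.ncard = m := by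
    have h := blue_ncard_snoc s.colour
    have h' : {v | Fin.snoc (α := fun _ => Colour) s.colour Colour.blue v = Colour.blue} =
        {v | t.colour v = Colour.blue} := by
      rw [← hphi]
      rfl
    rw [h', hb] at h
    omega
  refine ⟨hblue, ncard_red_of_ncard_blue hblue, fun v hv => ?_⟩
  have := h2 v.castSucc hv
  rwa [← hphi, phi_children_ncard] at this

theorem bijOn_phi (n m : ℕ) : Set.BijOn phi (setA n m) (setB (n + 1) (m + 1)) :=
  ⟨mapsTo_phi n m, (phi_injective n).injOn, surjOn_phi n m⟩

theorem ncard_setA_eq_ncard_setB (n m : ℕ) :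
    (setA n m).ncard = (setB (n + 1) (m + 1)).ncard := by
  rw [← (bijOn_phi n m).image_eq, Set.ncard_image_of_injective _ (phi_injective n)]

/-! ### Identification of the solution with `genB` -/

theorem mult_eq_ncard {n : ℕ} (a : InvFn n) (v : ℕ) :
    mult a v = {i : Fin n | (a i : ℕ) = v}.ncard := by
  rw [mult, Finset.sum_boole, Set.ncard_eq_toFinset_card']
  simp

open Classical in
theorem ncard_setA (n m : ℕ) : (setA n m).ncard =
    ∑ a : InvFn n, {S : Finset (Fin n) | S.card = m ∧ ∀ v ∉ S, 2 ≤ mult a v}.ncard := by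
  let F : InvFn n × Finset (Fin n) → ColouredInvSeq n := fun p =>
    { val := fun i => p.1 i
      isInvSeq := fun i => Nat.lt_succ_iff.1 (p.1 i).isLt
      colour := fun v => if v ∈ p.2 then Colour.blue else Colour.red }
  have hF : Function.Injective F := by
    rintro ⟨a, S⟩ ⟨b, T⟩ h
    have hv := congrArg ColouredInvSeq.val h
    have hc := congrArg ColouredInvSeq.colour h
    refine Prod.ext (funext fun i => Fin.ext (congrFun hv i)) (Finset.ext fun v => ?_)
    have := congrFun hc v
    by_cases h1 : v ∈ S <;> by_cases h2 : v ∈ T <;> simp_all [F]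
  have hblue : ∀ p, {v | (F p).colour v = Colour.blue}.ncard = p.2.card := fun p => by
    rw [← Set.ncard_coe_finset]
    congr 1
    ext v
    by_cases hv : v ∈ p.2 <;> simp [F, hv]
  have himage : setA n m =
      F '' (Finset.univ.filter fun p : InvFn n × Finset (Fin n) =>
        p.2.card = m ∧ ∀ v ∉ p.2, 2 ≤ mult p.1 v) := by
    ext s
    constructor
    · rintro ⟨hb, -, h2⟩
      have hs : F (fun i => ⟨s.val i, Nat.lt_succ_iff.2 (s.isInvSeq i)⟩,
          Finset.univ.filter fun v => s.colour v = Colour.blue) = s := by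
        refine ColouredInvSeq.ext rfl (funext fun v => ?_)
        by_cases hv : s.colour v = Colour.blue
        · simp [F, hv]
        · simp [F, Colour.eq_red_iff.2 hv]
      refine ⟨_, ?_, hs⟩
      rw [Finset.mem_coe, Finset.mem_filter]
      refine ⟨Finset.mem_univ _, ?_, fun v hv => ?_⟩
      · rw [← hblue, hs, hb]
      · rw [mult_eq_ncard]
        exact h2 v (Colour.eq_red_iff.2 (by simpa using hv))
    · rintro ⟨p, hp, rfl⟩
      rw [Finset.mem_coe, Finset.mem_filter] at hp
      have hb := (hblue p).trans hp.2.1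
      refine ⟨hb, ncard_red_of_ncard_blue hb, fun v hv => ?_⟩
      have := hp.2.2 v (fun h => by simp [F, h] at hv)
      rwa [mult_eq_ncard] at this
  rw [himage, Set.ncard_image_of_injective _ hF, Set.ncard_coe_finset, Finset.card_filter,
    Fintype.sum_prod_type]
  refine Finset.sum_congr rfl fun a _ => ?_
  rw [← Finset.card_filter, ← Set.ncard_coe_finset]
  simp

open Classical in
-- Expanding the product, `S` is the set of nodes contributing `y`, that is, the blue ones; each
-- remaining factor is 1 or 0 according as red is allowed there.
theorem coeff_prod_nodeWeight {n : ℕ} (a : InvFn n) (m : ℕ) :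
    PowerSeries.coeff m (∏ v : Fin n, nodeWeight (PowerSeries.X : ℚ⟦X⟧) (mult a v)) =
      ({S : Finset (Fin n) | S.card = m ∧ ∀ v ∉ S, 2 ≤ mult a v}.ncard : ℚ) := by
  have h : {S : Finset (Fin n) | S.card = m ∧ ∀ v ∉ S, 2 ≤ mult a v} =
      (Finset.univ.filter fun S : Finset (Fin n) => S.card = m ∧ ∀ v ∉ S, 2 ≤ mult a v) := by
    simp
  rw [h, Set.ncard_coe_finset, Finset.card_filter, Nat.cast_sum]
  simp only [nodeWeight]
  rw [Finset.prod_add, map_sum, Finset.powerset_univ]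
  refine Finset.sum_congr rfl fun S _ => ?_
  rw [Finset.prod_const]
  by_cases hS : ∀ v ∉ S, 2 ≤ mult a v
  · rw [Finset.prod_eq_one fun v hv => if_pos (hS v (Finset.mem_sdiff.1 hv).2), mul_one,
      PowerSeries.coeff_X_pow]
    by_cases hm : S.card = m
    · rw [if_pos hm.symm, if_pos ⟨hm, hS⟩, Nat.cast_one]
    · rw [if_neg (Ne.symm hm), if_neg (fun h => hm h.1), Nat.cast_zero]
  · push Not at hS
    obtain ⟨v, hv, h2⟩ := hS
    rw [Finset.prod_eq_zero (Finset.mem_sdiff.2 ⟨Finset.mem_univ v, hv⟩) (if_neg (by omega)),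
      mul_zero, map_zero, if_neg (fun h => absurd (h.2 v hv) (by omega)), Nat.cast_zero]

theorem coeff_coeff_genB (n m : ℕ) :
    ((n + 1)! : ℚ) * PowerSeries.coeff (m + 1) (PowerSeries.coeff (n + 1) genB) =
      ((setB (n + 1) (m + 1)).ncard : ℚ) := by
  rw [genB, PowerSeries.coeff_mk, PowerSeries.coeff_mk, if_pos ⟨by omega, by omega⟩,
    mul_div_cancel₀]
  exact_mod_cast Nat.factorial_ne_zero _

theorem eq_genB {B : ℚ⟦X⟧⟦X⟧} (h0 : PowerSeries.constantCoeff B = 0)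
    (h : ∀ n : ℕ, ((n + 1)! : ℚ⟦X⟧) * PowerSeries.coeff (n + 1) B =
      ∑ a : InvFn n, ∏ v ∈ Finset.range (n + 1), nodeWeight PowerSeries.X (mult a v)) :
    B = genB := by
  ext n m
  cases n with
  | zero => simp [genB, h0]
  | succ n =>
    have h1 := congrArg (PowerSeries.coeff m) (h n)
    rw [← nsmul_eq_mul, map_nsmul, nsmul_eq_mul] at h1
    have hf : ((n + 1)! : ℚ) ≠ 0 := by exact_mod_cast Nat.factorial_ne_zero _
    refine mul_left_cancel₀ hf (h1.trans ?_)
    have h2 : ∀ a : InvFn n, ∏ v ∈ Finset.range (n + 1),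
        nodeWeight (PowerSeries.X : ℚ⟦X⟧) (mult a v) =
        (∏ v : Fin n, nodeWeight PowerSeries.X (mult a v)) * PowerSeries.X := fun a => by
      -- The value `n` cannot occur in a sequence of length `n`, so the top node has weight exactly
      -- `y`; this accounts for the shift from `m` to `m + 1`.
      rw [Finset.prod_range_succ, mult_of_le a le_rfl, Finset.prod_range]
      simp [nodeWeight]
    simp only [h2]
    rw [map_sum]
    cases m with
    | zero => simp [genB]
    | succ m =>
      rw [coeff_coeff_genB, ← ncard_setA_eq_ncard_setB, ncard_setA, Nat.cast_sum]
      refine Finset.sum_congr rfl fun a _ => ?_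
      rw [PowerSeries.coeff_succ_mul_X, coeff_prod_nodeWeight]

theorem genB_differential_equation :
    PowerSeries.derivative ℚ⟦X⟧ genB =
        (PowerSeries.C PowerSeries.X + 1) * (PowerSeries.exp ℚ⟦X⟧).subst genB - genB - 1 ∧
      PowerSeries.constantCoeff genB = 0 := by
  obtain ⟨B, h0, hB, h⟩ := exists_exp_solution (PowerSeries.X : ℚ⟦X⟧)
  rw [← eq_genB h0 h]
  exact ⟨hB, h0⟩

/-! ### Order isomorphism and standardisation -/

/-- Order-isomorphic sequences. -/
def SameOrder {k : ℕ} (α β : Fin k → ℕ) : Prop := ∀ i j : Fin k, α i < α j ↔ β i < β j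

namespace SameOrder

variable {k : ℕ} {α β γ : Fin k → ℕ}

theorem symm (h : SameOrder α β) : SameOrder β α := fun i j => (h i j).symm

theorem trans (h : SameOrder α β) (h' : SameOrder β γ) : SameOrder α γ :=
  fun i j => (h i j).trans (h' i j)

theorem comp {l : ℕ} (h : SameOrder α β) (f : Fin l → Fin k) : SameOrder (α ∘ f) (β ∘ f) :=
  fun i j => h (f i) (f j)

theorem le_iff (h : SameOrder α β) (i j : Fin k) : α i ≤ α j ↔ β i ≤ β j := by
  rw [← not_lt, ← not_lt, h]

theorem eq_iff (h : SameOrder α β) (i j : Fin k) : α i = α j ↔ β i = β j := by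
  rw [le_antisymm_iff, le_antisymm_iff, h.le_iff, h.le_iff]

theorem exists_comp (h : SameOrder α β) :
    ∃ g : ℕ → ℕ, (∀ i, β i = g (α i)) ∧ Set.InjOn g (Set.range α) := by
  have hf : Function.FactorsThrough β α := fun i j hij => (h.eq_iff i j).1 hij
  refine ⟨Function.extend α β 0, fun i => (hf.extend_apply 0 i).symm, ?_⟩
  rintro _ ⟨i, rfl⟩ _ ⟨j, rfl⟩ hij
  rw [hf.extend_apply, hf.extend_apply] at hij
  exact (h.eq_iff i j).2 hij

theorem card_image (h : SameOrder α β) (s : Finset (Fin k)) :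
    (s.image α).card = (s.image β).card := by
  obtain ⟨g, hg, hinj⟩ := h.exists_comp
  have : s.image β = (s.image α).image g := by
    rw [Finset.image_image]
    exact Finset.image_congr fun i _ => hg i
  rw [this, eq_comm]
  refine Finset.card_image_of_injOn ?_
  exact hinj.mono fun v hv => by
    obtain ⟨i, -, rfl⟩ := Finset.mem_image.1 hv
    exact ⟨i, rfl⟩

end SameOrder

theorem Contains.trans {a b c : ℕ} {α : Fin a → ℕ} {β : Fin b → ℕ} {γ : Fin c → ℕ}
    (h : Contains α β) (h' : Contains β γ) : Contains α γ := by
  obtain ⟨f, hf, hf'⟩ := h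
  obtain ⟨g, hg, hg'⟩ := h'
  exact ⟨g ∘ f, hg.comp hf, fun i j => (hf' i j).trans (hg' _ _)⟩

theorem Contains.length_le {a b : ℕ} {α : Fin a → ℕ} {β : Fin b → ℕ} (h : Contains α β) :
    a ≤ b := by
  obtain ⟨f, hf, -⟩ := h
  simpa using Fintype.card_le_of_injective f hf.injective

theorem Contains.sameOrder {a : ℕ} {α β : Fin a → ℕ} (h : Contains α β) : SameOrder α β := by
  obtain ⟨f, hf, hf'⟩ := h
  have : f = id := (StrictMono.range_inj hf strictMono_id).1 (by
    rw [Set.range_id, (Finite.injective_iff_surjective.1 hf.injective).range_eq])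
  subst this
  exact hf'

theorem SameOrder.contains {a : ℕ} {α β : Fin a → ℕ} (h : SameOrder α β) : Contains α β :=
  ⟨id, strictMono_id, h⟩

/-- The number of distinct values of `σ` below `x`. -/
def rank {k : ℕ} (σ : Fin k → ℕ) (x : ℕ) : ℕ := ((Finset.univ.image σ).filter (· < x)).card

theorem rank_le {k : ℕ} (σ : Fin k → ℕ) (x : ℕ) : rank σ x ≤ x := by
  have : (Finset.univ.image σ).filter (· < x) ⊆ Finset.range x := fun v hv =>
    Finset.mem_range.2 (Finset.mem_filter.1 hv).2
  simpa [rank] using Finset.card_le_card this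

theorem rank_mono {k : ℕ} (σ : Fin k → ℕ) : Monotone (rank σ) := fun _ _ h =>
  Finset.card_le_card (Finset.monotone_filter_right _ fun _ _ hv => lt_of_lt_of_le hv h)

theorem rank_lt_rank {k : ℕ} {σ : Fin k → ℕ} {i : Fin k} {y : ℕ} (h : σ i < y) :
    rank σ (σ i) < rank σ y := by
  refine Finset.card_lt_card (Finset.ssubset_iff_of_subset
    (Finset.monotone_filter_right _ fun _ _ hv => lt_trans hv h) |>.2 ⟨σ i, ?_, ?_⟩)
  · simpa using h
  · simp

/-- The values of `ρ` below `ρ j` are exactly `0, …, ρ j - 1`, and an order isomorphism preserves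
the number of distinct smaller values. -/
theorem rank_eq_of_sameOrder {k : ℕ} {ρ σ : Fin k → ℕ} (hρ : IsCayley ρ) (h : SameOrder ρ σ)
    (j : Fin k) : rank σ (σ j) = ρ j := by
  have h1 : (Finset.univ.image σ).filter (· < σ j) =
      (Finset.univ.filter fun i => ρ i < ρ j).image σ := by
    simp_rw [h _ j, Finset.filter_image]
  have h2 : (Finset.univ.filter fun i => ρ i < ρ j).image ρ = Finset.range (ρ j) := by
    ext v
    simp only [Finset.mem_image, Finset.mem_filter, Finset.mem_univ, true_and, Finset.mem_range]
    constructor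
    · rintro ⟨i, hi, rfl⟩
      exact hi
    · intro hv
      obtain ⟨i, rfl⟩ := hρ j hv.le
      exact ⟨i, hv, rfl⟩
  rw [rank, h1, ← h.card_image, h2, Finset.card_range]

/-- The Cayley permutation that is order-isomorphic to `σ`. -/
def std {k : ℕ} (σ : Fin k → ℕ) : Fin k → ℕ := fun i => rank σ (σ i)

theorem sameOrder_std {k : ℕ} (σ : Fin k → ℕ) : SameOrder (std σ) σ := fun _ _ =>
  ⟨fun h => lt_of_not_ge fun h' => absurd (rank_mono σ h') (not_le.2 h), fun h => rank_lt_rank h⟩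

theorem isCayley_std {k : ℕ} (σ : Fin k → ℕ) : IsCayley (std σ) := by
  intro j v hv
  rcases eq_or_lt_of_le (Set.mem_Iic.1 hv) with rfl | hv
  · exact ⟨j, rfl⟩
  have himage : ((Finset.univ.filter fun i => σ i < σ j).image (std σ)) =
      Finset.range (std σ j) := by
    refine Finset.eq_of_subset_of_card_le (fun w hw => ?_) ?_
    · obtain ⟨i, hi, rfl⟩ := Finset.mem_image.1 hw
      exact Finset.mem_range.2 (rank_lt_rank (Finset.mem_filter.1 hi).2)
    · rw [(sameOrder_std σ).card_image, Finset.card_range, std, rank, Finset.filter_image]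
  obtain ⟨i, -, hi⟩ := Finset.mem_image.1 (himage ▸ Finset.mem_range.2 hv)
  exact ⟨i, hi⟩

/-! ### Necessary shape of minimal sequences -/

/-- Only entries after `p` are at risk, since their positions drop by one. If none of them is on the
diagonal, there is room. If the value at `p` is unique, larger values drop by one too, while values
at most `σ p` are at most `p` already. -/
theorem isInvSeq_std_deletion {N : ℕ} {σ : Fin (N + 1) → ℕ} (hσ : IsInvSeq σ) (p : Fin (N + 1))
    (h : (∀ q, q ≠ p → σ q ≠ σ p) ∨ ∀ l, p < l → σ l ≠ (l : ℕ)) :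
    IsInvSeq (std (σ ∘ p.succAbove)) := by
  intro j
  have hle := rank_le (σ ∘ p.succAbove) (σ (p.succAbove j))
  change rank (σ ∘ p.succAbove) (σ (p.succAbove j)) ≤ j
  rcases lt_or_ge j.castSucc p with hj | hj
  · have := hσ (p.succAbove j)
    rw [Fin.succAbove_of_castSucc_lt _ _ hj] at this hle ⊢
    exact hle.trans this
  · rw [Fin.succAbove_of_le_castSucc _ _ hj] at hle ⊢
    have hinv := hσ j.succ
    have hp := hσ p
    have hpj : (p : ℕ) ≤ j := hj
    rw [Fin.val_succ] at hinv
    rcases h with h | h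
    · rcases lt_or_ge (σ p) (σ j.succ) with hlt | hge
      · have hsub : (Finset.univ.image (σ ∘ p.succAbove)).filter (· < σ j.succ) ⊆
            (Finset.range (σ j.succ)).erase (σ p) := by
          intro v hv
          obtain ⟨hv1, hv2⟩ := Finset.mem_filter.1 hv
          obtain ⟨i, -, rfl⟩ := Finset.mem_image.1 hv1
          exact Finset.mem_erase.2 ⟨h _ (Fin.succAbove_ne p i), Finset.mem_range.2 hv2⟩
        have := Finset.card_le_card hsub
        rw [Finset.card_erase_of_mem (Finset.mem_range.2 hlt), Finset.card_range] at this
        rw [rank]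
        omega
      · omega
    · have := h j.succ (Fin.lt_def.2 (by rw [Fin.val_succ]; omega))
      rw [Fin.val_succ] at this
      omega

theorem IsMinimalFor.deletion {k N : ℕ} {ρ : Fin k → ℕ} {σ : Fin N → ℕ} (h : IsMinimalFor ρ σ)
    {f : Fin k → Fin N} (hf : StrictMono f) (hfσ : SameOrder ρ (σ ∘ f)) {p : Fin N}
    (hp : p ∉ Set.range f) :
    (∃ q, q ≠ p ∧ σ q = σ p) ∧ ∃ l, p < l ∧ σ l = (l : ℕ) := by
  obtain _ | N := N
  · exact p.elim0
  by_contra hcon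
  have hcond : (∀ q, q ≠ p → σ q ≠ σ p) ∨ ∀ l, p < l → σ l ≠ (l : ℕ) := by
    rcases not_and_or.1 hcon with h1 | h1 <;> push Not at h1
    · exact Or.inl h1
    · exact Or.inr h1
  have hex : ∀ i, ∃ j, p.succAbove j = f i := fun i =>
    Fin.exists_succAbove_eq fun hi => hp ⟨i, hi⟩
  choose g hg using hex
  have hgm : StrictMono g := fun i j hij => by
    rw [← (Fin.strictMono_succAbove p).lt_iff_lt, hg, hg]
    exact hf hij
  have hc : Contains ρ (std (σ ∘ p.succAbove)) := by
    refine ⟨g, hgm, hfσ.trans ?_⟩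
    have := (sameOrder_std (σ ∘ p.succAbove)).symm.comp g
    have he : (σ ∘ p.succAbove) ∘ g = σ ∘ f := funext fun i => congrArg σ (hg i)
    rwa [he] at this
  have := (h.2 _ _ ⟨isInvSeq_std_deletion h.1.1 p hcond, isCayley_std _, hc⟩
    ⟨p.succAbove, Fin.strictMono_succAbove p, sameOrder_std _⟩).length_le
  omega

theorem card_compl_image {a b : ℕ} {f : Fin a → Fin b} (hf : Function.Injective f) :
    (Finset.univ.image f)ᶜ.card = b - a := by
  rw [Finset.card_compl, Finset.card_image_of_injective _ hf, Finset.card_univ, Fintype.card_fin,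
    Fintype.card_fin]

theorem Iio_subset_compl_image {k N : ℕ} [NeZero k] {f : Fin k → Fin N} (hf : StrictMono f) :
    Finset.Iio (f 0) ⊆ (Finset.univ.image f)ᶜ := by
  intro x hx
  rw [Finset.mem_compl, Finset.mem_image]
  rintro ⟨i, -, rfl⟩
  exact absurd (hf.monotone (Fin.zero_le i)) (not_le.2 (Finset.mem_Iio.1 hx))

/-- A double count with `s = σ (f 0)`: at least `n - s` values from `s` on are missing from the
occurrence, each is taken by two positions outside it, but only `n - s` such positions can serve.
Hence `n ≤ s`, while `s ≤ f 0 ≤ n`. -/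
theorem occurrence_start_eq {n k m : ℕ} [NeZero k] {ρ : Fin k → ℕ} (hρ : IsCayley ρ)
    (h0 : ρ 0 = m) (hm : ∀ i : Fin k, ρ i ≤ m + i) {σ : Fin (n + k) → ℕ} (hinv : IsInvSeq σ)
    (hσ : IsCayley σ) {f : Fin k → Fin (n + k)} (hf : StrictMono f) (hfσ : SameOrder ρ (σ ∘ f))
    (hdel : ∀ p ∉ Set.range f, (∃ q, q ≠ p ∧ σ q = σ p) ∧ ∃ l, p < l ∧ σ l = (l : ℕ)) :
    (f 0 : ℕ) = n ∧ σ (f 0) = n := by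
  set R := (Finset.univ.image f)ᶜ with hR
  have hmemR : ∀ p, p ∈ R ↔ p ∉ Set.range f := fun p => by simp [hR]
  have hcardR : R.card = n := by rw [hR, card_compl_image hf.injective]; omega
  have hsub : Finset.Iio (f 0) ⊆ R := Iio_subset_compl_image hf
  have hf0 : (f 0 : ℕ) ≤ n := by
    have := Finset.card_le_card hsub
    rwa [Fin.card_Iio, hcardR] at this
  set s := σ (f 0) with hs
  have hsf : s ≤ f 0 := hinv (f 0)
  suffices hns : n ≤ s by omega
  rcases R.eq_empty_or_nonempty with hemp | hne
  · rw [hemp, Finset.card_empty] at hcardR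
    omega
  -- Taking the last position outside the occurrence gives a diagonal entry beyond all of `R`; it
  -- belongs to the occurrence, and all `n` positions of `R` precede it.
  obtain ⟨-, L, hpL, hL⟩ := hdel _ ((hmemR _).1 (R.max'_mem hne))
  have hRL : ∀ p ∈ R, p < L := fun p hp => (R.le_max' p hp).trans_lt hpL
  obtain ⟨j, rfl⟩ : ∃ j, f j = L := by
    by_contra hcon
    exact lt_irrefl _ (hRL L ((hmemR L).2 hcon))
  have hLn : (f j : ℕ) = n + j := by
    have hun : Finset.Iio (f j) = R ∪ (Finset.Iio j).image f := by
      ext x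
      rw [Finset.mem_union, Finset.mem_Iio, Finset.mem_image]
      constructor
      · intro hx
        by_cases hxR : x ∈ R
        · exact Or.inl hxR
        · obtain ⟨i, rfl⟩ := not_not.1 (fun h => hxR ((hmemR x).2 h))
          exact Or.inr ⟨i, Finset.mem_Iio.2 (hf.lt_iff_lt.1 hx), rfl⟩
      · rintro (hx | ⟨i, hi, rfl⟩)
        · exact hRL x hx
        · exact hf (Finset.mem_Iio.1 hi)
    have hdisj : Disjoint R ((Finset.Iio j).image f) :=
      Finset.disjoint_left.2 fun x hx hx' => by
        obtain ⟨i, -, rfl⟩ := Finset.mem_image.1 hx'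
        exact (hmemR _).1 hx ⟨i, rfl⟩
    have := congrArg Finset.card hun
    rwa [Finset.card_union_of_disjoint hdisj, Finset.card_image_of_injective _ hf.injective,
      Fin.card_Iio, Fin.card_Iio, hcardR] at this
  set V := Finset.univ.image (σ ∘ f) with hV
  have hmissing : ∀ i, ρ i + ((Finset.range (σ (f i))).filter (· ∉ V)).card = σ (f i) := by
    intro i
    have h1 : V.filter (· < σ (f i)) = (Finset.range (σ (f i))).filter (· ∈ V) := by
      ext v
      simp only [Finset.mem_filter, Finset.mem_range]
      tauto
    have h2 : rank (σ ∘ f) (σ (f i)) = ρ i := rank_eq_of_sameOrder hρ hfσ i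
    rw [rank, ← hV, h1] at h2
    have := Finset.card_filter_add_card_filter_not (s := Finset.range (σ (f i))) (· ∈ V)
    rwa [h2, Finset.card_range] at this
  set E := (Finset.range (σ (f j))).filter fun v => s ≤ v ∧ v ∉ V with hE
  have hEcard : n ≤ s + E.card := by
    have hsubE : (Finset.range (σ (f j))).filter (· ∉ V) ⊆
        (Finset.range s).filter (· ∉ V) ∪ E := by
      intro v hv
      simp only [hE, Finset.mem_union, Finset.mem_filter, Finset.mem_range] at hv ⊢
      rcases lt_or_ge v s with h | h <;> tauto
    have h1 := (Finset.card_le_card hsubE).trans (Finset.card_union_le _ _)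
    have h2 := hmissing j
    have h3 := hmissing 0
    have h4 := hm j
    rw [← hs] at h3
    omega
  -- The `s` positions before `s ≤ f 0` all lie in `R`, and none of them can carry a value that is
  -- at least `s`.
  have hRs : (R.filter fun p : Fin (n + k) => s ≤ (p : ℕ)).card + s ≤ n := by
    have hlt : s < n + k := hsf.trans_lt (f 0).isLt
    have h1 : Finset.Iio (⟨s, hlt⟩ : Fin (n + k)) ⊆ R.filter fun p : Fin (n + k) => ¬ s ≤ (p : ℕ) := by
      intro x hx
      have hx' : (x : ℕ) < s := Fin.lt_def.1 (Finset.mem_Iio.1 hx)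
      exact Finset.mem_filter.2
        ⟨hsub (Finset.mem_Iio.2 (Fin.lt_def.2 (hx'.trans_le hsf))), not_le.2 hx'⟩
    have h2 := Finset.card_le_card h1
    rw [Fin.card_Iio] at h2
    have h3 := Finset.card_filter_add_card_filter_not (s := R) fun p : Fin (n + k) => s ≤ (p : ℕ)
    simp only at h2
    omega
  have hfib : E.card * 2 ≤ (R.filter fun p : Fin (n + k) => s ≤ (p : ℕ)).card := by
    have h1 : ∑ v ∈ E, ((R.filter fun p : Fin (n + k) => s ≤ (p : ℕ)).filter fun p => σ p = v).card ≤
        (R.filter fun p : Fin (n + k) => s ≤ (p : ℕ)).card := by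
      rw [← Finset.card_biUnion]
      · exact Finset.card_le_card (Finset.biUnion_subset.2 fun v _ => Finset.filter_subset _ _)
      · intro v _ w _ hvw
        exact Finset.disjoint_left.2 fun p hp hp' =>
          hvw ((Finset.mem_filter.1 hp).2.symm.trans (Finset.mem_filter.1 hp').2)
    refine le_trans ?_ h1
    rw [← smul_eq_mul]
    refine Finset.card_nsmul_le_sum _ _ _ fun v hv => ?_
    obtain ⟨hv1, hv2, hv3⟩ := Finset.mem_filter.1 hv
    have hfiber : ∀ q, σ q = v → q ∈ (R.filter fun p : Fin (n + k) => s ≤ (p : ℕ)).filter fun p => σ p = v := by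
      intro q hq
      refine Finset.mem_filter.2 ⟨Finset.mem_filter.2 ⟨(hmemR q).2 ?_, ?_⟩, hq⟩
      · rintro ⟨i, rfl⟩
        exact hv3 (Finset.mem_image.2 ⟨i, Finset.mem_univ i, hq⟩)
      · exact (hv2.trans hq.ge).trans (hinv q)
    obtain ⟨p, rfl⟩ := hσ (f j) (Finset.mem_range.1 hv1).le
    have hpR := (Finset.mem_filter.1 (Finset.mem_filter.1 (hfiber p rfl)).1).1
    obtain ⟨⟨q, hqp, hq⟩, -⟩ := hdel p ((hmemR p).1 hpR)
    exact Finset.one_lt_card.2 ⟨q, hfiber q hq, p, hfiber p rfl, hqp⟩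
  omega

/-- Inversion sequences that are Cayley permutations, consisting of a prefix of length `n` whose
values are repeated and a suffix that starts on the diagonal and is order-isomorphic to `ρ`. -/
structure IsSuffixExtension {n k : ℕ} [NeZero k] (ρ : Fin k → ℕ) (σ : Fin (n + k) → ℕ) :
    Prop where
  isInvSeq : IsInvSeq σ
  isCayley : IsCayley σ
  sameOrder : SameOrder ρ (σ ∘ Fin.natAdd n)
  start : σ (Fin.natAdd n 0) = n
  repeated : ∀ p : Fin (n + k), (p : ℕ) < n → ∃ q, q ≠ p ∧ σ q = σ p

theorem mem_range_natAdd {n k : ℕ} {x : Fin (n + k)} :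
    x ∈ Set.range (Fin.natAdd n : Fin k → Fin (n + k)) ↔ n ≤ (x : ℕ) := by
  constructor
  · rintro ⟨i, rfl⟩
    simp
  · intro h
    exact ⟨⟨x - n, by omega⟩, Fin.ext (by simp; omega)⟩

theorem IsMinimalFor.isSuffixExtension {n k m : ℕ} [NeZero k] {ρ : Fin k → ℕ} (hρ : IsCayley ρ)
    (h0 : ρ 0 = m) (hm : ∀ i : Fin k, ρ i ≤ m + i) {σ : Fin (n + k) → ℕ}
    (h : IsMinimalFor ρ σ) : IsSuffixExtension ρ σ := by
  obtain ⟨f, hf, hfσ⟩ := h.1.2.2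
  have hdel : ∀ p ∉ Set.range f, _ := fun p hp => h.deletion hf hfσ hp
  obtain ⟨hf0, hs⟩ := occurrence_start_eq hρ h0 hm h.1.1 h.1.2.1 hf hfσ hdel
  have hR : Finset.Iio (f 0) = (Finset.univ.image f)ᶜ :=
    Finset.eq_of_subset_of_card_le (Iio_subset_compl_image hf) (by
      rw [card_compl_image hf.injective, Fin.card_Iio]
      omega)
  have hrange : ∀ x, x ∈ Set.range f ↔ n ≤ (x : ℕ) := fun x => by
    have := congrArg (x ∈ ·) hR
    simp only [Finset.mem_Iio, Finset.mem_compl, Finset.mem_image, Finset.mem_univ, true_and,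
      eq_iff_iff, Fin.lt_def, hf0] at this
    rw [← not_lt, this, not_not]
    rfl
  have hfn : f = Fin.natAdd n := (StrictMono.range_inj hf (Fin.strictMono_natAdd n)).1
    (Set.ext fun x => (hrange x).trans mem_range_natAdd.symm)
  subst hfn
  exact ⟨h.1.1, h.1.2.1, hfσ, hs, fun p hp =>
    (hdel p fun hp' => absurd ((hrange p).1 hp') (not_le.2 hp)).1⟩

/-! ### Suffix extensions of different lengths are incomparable -/

/-- The values of `σ` that are at least `σ j` and occur at least `c` times. -/
def frequentValues {N : ℕ} (c : ℕ) (σ : Fin N → ℕ) (j : Fin N) : Finset ℕ :=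
  (Finset.univ.filter fun i => σ j ≤ σ i ∧
    c ≤ (Finset.univ.filter fun l => σ l = σ i).card).image σ

/-- By `H`, every entry whose value is counted on the larger side lies in the image of `e`, so
multiplicities of these values are preserved. -/
theorem card_frequentValues {a b : ℕ} (c : ℕ) {α : Fin a → ℕ} {β : Fin b → ℕ} {e : Fin a → Fin b}
    (he : Function.Injective e) (h : SameOrder α (β ∘ e)) (j : Fin a)
    (H : ∀ q, β (e j) ≤ β q → c ≤ (Finset.univ.filter fun l => β l = β q).card →
      q ∈ Set.range e) :
    (frequentValues c α j).card = (frequentValues c β (e j)).card := by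
  have hsub : ∀ i, (Finset.univ.filter fun l => α l = α i).image e ⊆
      Finset.univ.filter fun l => β l = β (e i) := by
    intro i x hx
    obtain ⟨l, hl, rfl⟩ := Finset.mem_image.1 hx
    exact Finset.mem_filter.2 ⟨Finset.mem_univ _, (h.eq_iff l i).1 (Finset.mem_filter.1 hl).2⟩
  have himage : frequentValues c β (e j) = (Finset.univ.filter fun i => α j ≤ α i ∧
      c ≤ (Finset.univ.filter fun l => α l = α i).card).image (β ∘ e) := by
    ext w
    simp only [frequentValues, Finset.mem_image, Finset.mem_filter, Finset.mem_univ, true_and]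
    constructor
    · rintro ⟨q, ⟨hq1, hq2⟩, rfl⟩
      obtain ⟨i, rfl⟩ := H q hq1 hq2
      refine ⟨i, ⟨(h.le_iff j i).2 hq1, ?_⟩, rfl⟩
      have heq : (Finset.univ.filter fun l => α l = α i).image e =
          Finset.univ.filter fun l => β l = β (e i) := by
        refine (hsub i).antisymm fun l hl => ?_
        have hl' := (Finset.mem_filter.1 hl).2
        obtain ⟨l, rfl⟩ := H l (hl' ▸ hq1) (by rwa [hl'])
        exact Finset.mem_image_of_mem e
          (Finset.mem_filter.2 ⟨Finset.mem_univ _, (h.eq_iff l i).2 hl'⟩)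
      rwa [← heq, Finset.card_image_of_injective _ he] at hq2
    · rintro ⟨i, ⟨hi1, hi2⟩, rfl⟩
      refine ⟨e i, ⟨(h.le_iff j i).1 hi1, hi2.trans ?_⟩, rfl⟩
      rw [← Finset.card_image_of_injective _ he]
      exact Finset.card_le_card (hsub i)
  rw [himage, frequentValues, h.card_image]

namespace IsSuffixExtension

variable {n k : ℕ} [NeZero k] {ρ : Fin k → ℕ} {σ : Fin (n + k) → ℕ}

theorem card_frequentValues (h : IsSuffixExtension ρ σ) (c : ℕ) :
    (frequentValues c ρ 0).card = (frequentValues c σ (Fin.natAdd n 0)).card := by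
  refine InvSeq.card_frequentValues c (Fin.natAdd_injective k n) h.sameOrder 0 fun q hq _ => ?_
  rw [h.start] at hq
  exact mem_range_natAdd.2 (hq.trans (h.isInvSeq q))

/-- All values below `n` occur, and values from `n` on can only occur in the suffix. The second
summand depends on `ρ` alone. -/
theorem card_image (h : IsSuffixExtension ρ σ) :
    (Finset.univ.image σ).card = n + (frequentValues 1 ρ 0).card := by
  have hun : Finset.univ.image σ = Finset.range n ∪ frequentValues 1 σ (Fin.natAdd n 0) := by
    ext v
    simp only [frequentValues, Finset.mem_union, Finset.mem_image, Finset.mem_filter,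
      Finset.mem_univ, true_and, Finset.mem_range, h.start]
    constructor
    · rintro ⟨i, rfl⟩
      rcases lt_or_ge (σ i) n with hi | hi
      · exact Or.inl hi
      · exact Or.inr ⟨i, ⟨hi, Finset.card_pos.2 ⟨i, by simp⟩⟩, rfl⟩
    · rintro (hv | ⟨i, -, rfl⟩)
      · exact h.isCayley (Fin.natAdd n 0) (by rw [h.start]; exact hv.le)
      · exact ⟨i, rfl⟩
  have hdisj : Disjoint (Finset.range n) (frequentValues 1 σ (Fin.natAdd n 0)) := by
    refine Finset.disjoint_left.2 fun v hv hv' => ?_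
    obtain ⟨i, hi, rfl⟩ := Finset.mem_image.1 hv'
    have := (Finset.mem_filter.1 hi).2.1
    rw [h.start] at this
    exact absurd (Finset.mem_range.1 hv) (not_lt.2 this)
  rw [hun, Finset.card_union_of_disjoint hdisj, Finset.card_range, h.card_frequentValues]

/-- Value counts force the deleted entries to have unique values, so the whole prefix of `σ`
survives and `τ` starts its copy of `ρ` at the prefix entry `n'` of `σ`. That entry is repeated, so
`σ` has more repeated values from `n'` on than from `n` on; but both numbers equal the one
determined by `ρ`. -/
theorem not_contains {n' : ℕ} {τ : Fin (n' + k) → ℕ} (hσ : IsSuffixExtension ρ σ)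
    (hτ : IsSuffixExtension ρ τ) (hn : n' < n) : ¬ Contains τ σ := by
  rintro ⟨f, hf, hτσ⟩
  replace hτσ : SameOrder τ (σ ∘ f) := hτσ
  set R := (Finset.univ.image f)ᶜ with hR
  have hmemR : ∀ p, p ∈ R ↔ p ∉ Set.range f := fun p => by simp [hR]
  have hcardR : R.card = n - n' := by rw [hR, card_compl_image hf.injective]; omega
  have hun : Finset.univ.image σ = Finset.univ.image (σ ∘ f) ∪ R.image σ := by
    rw [← Finset.image_image, ← Finset.image_union, hR, Finset.union_compl]
  have hcard := congrArg Finset.card hun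
  have hcard1 := hτσ.card_image Finset.univ
  rw [hσ.card_image] at hcard
  rw [hτ.card_image] at hcard1
  have hle := Finset.card_union_le (Finset.univ.image (σ ∘ f)) (R.image σ)
  have hle' : (R.image σ).card ≤ R.card := Finset.card_image_le
  -- Passing from `σ` to `τ` loses `n - n'` distinct values with only `n - n'` entries deleted, so
  -- both cardinality bounds are equalities.
  have hinj : Set.InjOn σ R := Finset.card_image_iff.1 (by omega)
  have hdisj : Disjoint (Finset.univ.image (σ ∘ f)) (R.image σ) :=
    Finset.card_union_eq_card_add_card.1 (by omega)
  have huniq : ∀ p q, q ≠ p → σ q = σ p → p ∈ Set.range f := by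
    intro p q hqp hq
    by_contra hp
    have hpR := (hmemR p).2 hp
    by_cases hqR : q ∈ R
    · exact hqp (hinj hqR hpR hq)
    · obtain ⟨i, rfl⟩ := not_not.1 fun h => hqR ((hmemR q).2 h)
      exact Finset.disjoint_left.1 hdisj (Finset.mem_image_of_mem (σ ∘ f) (Finset.mem_univ i))
        (Finset.mem_image.2 ⟨p, hpR, hq.symm⟩)
  have hprefix : ∀ p : Fin (n + k), (p : ℕ) < n → p ∈ Set.range f := fun p hp => by
    obtain ⟨q, hqp, hq⟩ := hσ.repeated p hp
    exact huniq p q hqp hq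
  set x : Fin (n + k) := ⟨n', by omega⟩ with hx
  obtain ⟨y, hy⟩ := hprefix x hn
  have hyn : (y : ℕ) = n' := by
    have himage : (Finset.Iio y).image f = Finset.Iio x := by
      ext z
      rw [Finset.mem_image, Finset.mem_Iio]
      constructor
      · rintro ⟨i, hi, rfl⟩
        rw [← hy]
        exact hf (Finset.mem_Iio.1 hi)
      · intro hz
        obtain ⟨i, rfl⟩ := hprefix z (lt_trans hz hn)
        rw [← hy] at hz
        exact ⟨i, Finset.mem_Iio.2 (hf.lt_iff_lt.1 hz), rfl⟩
    have := congrArg Finset.card himage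
    rwa [Finset.card_image_of_injective _ hf.injective, Fin.card_Iio, Fin.card_Iio] at this
  obtain rfl : y = Fin.natAdd n' 0 := Fin.ext (by simp [hyn])
  have hσx : σ x = n' := by
    refine le_antisymm (hσ.isInvSeq x) ?_
    have h1 := rank_eq_of_sameOrder hτ.isCayley hτσ (Fin.natAdd n' 0)
    have h2 := rank_le (σ ∘ f) ((σ ∘ f) (Fin.natAdd n' 0))
    rw [h1, hτ.start, Function.comp_apply, hy] at h2
    exact h2
  have hT : (frequentValues 2 τ (Fin.natAdd n' 0)).card = (frequentValues 2 σ x).card := by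
    rw [← hy]
    refine InvSeq.card_frequentValues 2 hf.injective hτσ _ fun q _ hq => ?_
    obtain ⟨p, hp, hpq⟩ := Finset.exists_mem_ne hq q
    exact huniq q p hpq (Finset.mem_filter.1 hp).2
  have hlt : (frequentValues 2 σ (Fin.natAdd n 0)).card < (frequentValues 2 σ x).card := by
    refine Finset.card_lt_card ((Finset.ssubset_iff_of_subset ?_).2 ⟨σ x, ?_, ?_⟩)
    · refine Finset.image_subset_image (Finset.monotone_filter_right _ fun i _ hi => ?_)
      exact ⟨le_trans (by rw [hσx, hσ.start]; exact hn.le) hi.1, hi.2⟩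
    · obtain ⟨q, hqx, hq⟩ := hσ.repeated x hn
      refine Finset.mem_image_of_mem σ (Finset.mem_filter.2 ⟨Finset.mem_univ _, le_rfl, ?_⟩)
      exact Finset.one_lt_card.2 ⟨q, by simp [hq], x, by simp, hqx⟩
    · intro hmem
      obtain ⟨i, hi, hi'⟩ := Finset.mem_image.1 hmem
      have := (Finset.mem_filter.1 hi).2.1
      rw [hi', hσx, hσ.start] at this
      omega
  rw [← hσ.card_frequentValues, ← hT, ← hτ.card_frequentValues] at hlt
  exact lt_irrefl _ hlt

end IsSuffixExtension

theorem exists_isMinimalFor {k : ℕ} {ρ : Fin k → ℕ} (N : ℕ) (τ : Fin N → ℕ) (hτ : InIP ρ τ) :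
    ∃ (l : ℕ) (τ' : Fin l → ℕ), IsMinimalFor ρ τ' ∧ Contains τ' τ := by
  induction N using Nat.strong_induction_on with
  | _ N ih =>
    by_cases hmin : IsMinimalFor ρ τ
    · exact ⟨N, τ, hmin, id, strictMono_id, fun _ _ => Iff.rfl⟩
    · obtain ⟨l, τ₁, h1, h2, h3⟩ : ∃ (l : ℕ) (τ₁ : Fin l → ℕ),
          InIP ρ τ₁ ∧ Contains τ₁ τ ∧ ¬ Contains τ τ₁ := by
        by_contra hcon
        push Not at hcon
        exact hmin ⟨hτ, hcon⟩
      rcases eq_or_lt_of_le h2.length_le with rfl | hlt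
      · exact absurd h2.sameOrder.symm.contains h3
      · obtain ⟨l', τ', h4, h5⟩ := ih l hlt τ₁ h1
        exact ⟨l', τ', h4, h5.trans h2⟩

/-- For sufficiency, any member of `IP[ρ]` below `σ` contains a minimal one, again a suffix
extension. Incomparability gives it the length of `σ`, so it is order-isomorphic to `σ`. -/
theorem isMinimalFor_iff {n k m : ℕ} [NeZero k] {ρ : Fin k → ℕ} (hρ : IsCayley ρ)
    (h0 : ρ 0 = m) (hm : ∀ i : Fin k, ρ i ≤ m + i) {σ : Fin (n + k) → ℕ} :
    IsMinimalFor ρ σ ↔ IsSuffixExtension ρ σ := by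
  refine ⟨fun h => h.isSuffixExtension hρ h0 hm, fun h => ⟨⟨h.isInvSeq, h.isCayley,
    Fin.natAdd n, Fin.strictMono_natAdd n, h.sameOrder⟩, fun l τ hτ hτσ => ?_⟩⟩
  obtain ⟨l', τ', hmin, hτ'τ⟩ := exists_isMinimalFor l τ hτ
  have hτ'σ := hτ'τ.trans hτσ
  obtain ⟨n', rfl⟩ := Nat.exists_eq_add_of_le' hmin.1.2.2.length_le
  have hle := hτ'σ.length_le
  rcases Nat.lt_or_ge n' n with hlt | hge
  · exact absurd hτ'σ (h.not_contains (hmin.isSuffixExtension hρ h0 hm) hlt)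
  · obtain rfl : n' = n := by omega
    exact hτ'σ.sameOrder.symm.contains.trans hτ'τ

/-! ### Coding suffix extensions by coloured inversion sequences -/

/-- The values available to the suffix of an extension: the blue ones, and all from `n` on. -/
def ColouredInvSeq.Available {n : ℕ} (s : ColouredInvSeq n) (v : ℕ) : Prop :=
  n ≤ v ∨ ∃ h : v < n, s.colour ⟨v, h⟩ = Colour.blue

theorem infinite_of_forall_ge {P : ℕ → Prop} {n : ℕ} (h : ∀ v, n ≤ v → P v) :
    (Set.ofPred P).Infinite :=
  (Set.Ici_infinite n).mono h

namespace ColouredInvSeq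

variable {n k : ℕ} (s : ColouredInvSeq n)

theorem infinite_available : (Set.ofPred s.Available).Infinite :=
  infinite_of_forall_ge fun _ h => Or.inl h

/-- The inversion sequence with prefix `s` whose suffix is order-isomorphic to `ρ` and has the
available values. -/
noncomputable def extend (ρ : Fin k → ℕ) : Fin (n + k) → ℕ :=
  Fin.append s.val fun i => Nat.nth s.Available (ρ i)

theorem extend_castAdd (ρ : Fin k → ℕ) (i : Fin n) : s.extend ρ (Fin.castAdd k i) = s.val i :=
  Fin.append_left _ _ _

theorem extend_natAdd (ρ : Fin k → ℕ) (i : Fin k) :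
    s.extend ρ (Fin.natAdd n i) = Nat.nth s.Available (ρ i) :=
  Fin.append_right _ _ _

open Classical in
theorem count_available_of_le {v : ℕ} (hv : v ≤ n) : Nat.count s.Available v =
    {i : Fin n | (i : ℕ) < v ∧ s.colour i = Colour.blue}.ncard := by
  rw [Nat.count_eq_card_filter_range, ← Set.ncard_coe_finset,
    ← Set.ncard_image_of_injective _ Fin.val_injective]
  congr 1
  ext w
  rw [Finset.mem_coe, Finset.mem_filter, Finset.mem_range]
  simp only [Set.mem_ofPred_eq, Set.mem_image, Available]
  constructor
  · rintro ⟨hw, h | ⟨h, hc⟩⟩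
    · omega
    · exact ⟨⟨w, h⟩, ⟨hw, hc⟩, rfl⟩
  · rintro ⟨i, ⟨hi, hc⟩, rfl⟩
    exact ⟨hi, Or.inr ⟨i.isLt, hc⟩⟩

variable {s} {m : ℕ}

open Classical in
theorem count_available (hs : s ∈ setA n m) (d : ℕ) : Nat.count s.Available (n + d) = m + d := by
  have h1 : Nat.count s.Available n = m := by
    rw [s.count_available_of_le le_rfl, ← hs.1]
    congr 1
    ext i
    simp
  rw [Nat.count_add, h1, Nat.count_of_forall]
  exact fun _ _ => Or.inl (Nat.le_add_right _ _)

theorem extend_natAdd_zero [NeZero k] {ρ : Fin k → ℕ} (h0 : ρ 0 = m) (hs : s ∈ setA n m) :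
    s.extend ρ (Fin.natAdd n 0) = n := by
  classical
  have h := Nat.nth_count (p := s.Available) (n := n) (Or.inl le_rfl)
  have hc : Nat.count s.Available n = m := count_available hs 0
  rwa [hc, ← h0, ← extend_natAdd] at h

theorem mem_range_suffix [NeZero k] {ρ : Fin k → ℕ} (hρ : IsCayley ρ) (i : Fin k) {v : ℕ}
    (hv : v ≤ s.extend ρ (Fin.natAdd n i)) (hP : s.Available v) :
    ∃ j : Fin k, s.extend ρ (Fin.natAdd n j) = v := by
  classical
  rw [extend_natAdd] at hv
  obtain ⟨j, hj⟩ := hρ i (a := Nat.count s.Available v)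
    ((Nat.count_le_iff_le_nth s.infinite_available).2 hv)
  exact ⟨j, by rw [extend_natAdd, hj, Nat.nth_count hP]⟩

theorem available_iff [NeZero k] {ρ : Fin k → ℕ} (hρ : IsCayley ρ) (h0 : ρ 0 = m)
    (hs : s ∈ setA n m) (v : Fin n) :
    s.colour v = Colour.blue ↔ ∃ j : Fin k, s.extend ρ (Fin.natAdd n j) = v := by
  constructor
  · intro h
    exact mem_range_suffix hρ 0 (by rw [extend_natAdd_zero h0 hs]; exact v.isLt.le)
      (Or.inr ⟨v.isLt, h⟩)
  · rintro ⟨j, hj⟩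
    have h := Nat.nth_mem_of_infinite s.infinite_available (ρ j)
    rw [← extend_natAdd, hj] at h
    rcases h with h | ⟨_, h⟩
    · exact absurd v.isLt (not_lt.2 h)
    · exact h

theorem isSuffixExtension_extend [NeZero k] {ρ : Fin k → ℕ} (hρ : IsCayley ρ) (h0 : ρ 0 = m)
    (hm : ∀ i : Fin k, ρ i ≤ m + i) (hs : s ∈ setA n m) : IsSuffixExtension ρ (s.extend ρ) := by
  classical
  have hstart := extend_natAdd_zero h0 hs
  have hred : ∀ v : Fin n, s.colour v ≠ Colour.blue →
      2 ≤ {i : Fin n | s.val i = (v : ℕ)}.ncard := fun v hv => hs.2.2 v (Colour.eq_red_iff.2 hv)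
  have hval : ∀ i : Fin n, s.val i < n := fun i => (s.isInvSeq i).trans_lt i.isLt
  have hsuffix : ∀ (i : Fin k) (v : ℕ), v ≤ s.extend ρ (Fin.natAdd n i) →
      v ∈ Set.range (s.extend ρ) := by
    intro i v hv
    by_cases hP : s.Available v
    · obtain ⟨j, hj⟩ := mem_range_suffix hρ i hv hP
      exact ⟨_, hj⟩
    · have hvn : v < n := lt_of_not_ge fun h => hP (Or.inl h)
      have h2 := hred ⟨v, hvn⟩ fun h => hP (Or.inr ⟨hvn, h⟩)
      obtain ⟨j, hj⟩ := Set.nonempty_of_ncard_ne_zero (two_pos.trans_le h2).ne'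
      exact ⟨Fin.castAdd k j, by rw [extend_castAdd]; exact hj⟩
  refine ⟨fun p => ?_, fun p => ?_, fun i j => ?_, hstart, fun p hp => ?_⟩
  · induction p using Fin.addCases with
    | left i =>
      rw [extend_castAdd]
      exact s.isInvSeq i
    | right i =>
      rw [extend_natAdd, Fin.val_natAdd, ← Nat.lt_succ_iff]
      refine Nat.nth_lt_of_lt_count ?_
      -- There are `m + i + 1` available values up to `n + i`, more than `ρ i ≤ m + i`; this is
      -- where the bound from `mdd` enters.
      rw [Nat.succ_eq_add_one, add_assoc, count_available hs]
      have := hm i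
      omega
  · induction p using Fin.addCases with
    | left i =>
      intro v hv
      rw [extend_castAdd] at hv
      exact hsuffix 0 v (by rw [hstart]; exact (hv.trans_lt (hval i)).le)
    | right i => exact fun v hv => hsuffix i v hv
  · simp only [Function.comp_apply, extend_natAdd]
    exact (Nat.nth_lt_nth s.infinite_available).symm
  · obtain ⟨i, rfl⟩ : ∃ i : Fin n, Fin.castAdd k i = p := ⟨⟨p, hp⟩, rfl⟩
    rw [extend_castAdd]
    -- A blue value recurs in the suffix, a red one within the prefix.
    by_cases hb : s.colour ⟨s.val i, hval i⟩ = Colour.blue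
    · obtain ⟨j, hj⟩ := (available_iff hρ h0 hs _).1 hb
      exact ⟨_, fun h => by simpa using (congrArg Fin.val h).trans_lt i.isLt, hj⟩
    · obtain ⟨j, hj, hji⟩ := Set.exists_ne_of_one_lt_ncard (hred _ hb) i
      exact ⟨Fin.castAdd k j, fun h => hji (Fin.castAdd_injective n k h), by
        rw [extend_castAdd]; exact hj⟩

end ColouredInvSeq

theorem injOn_extend {n k m : ℕ} [NeZero k] {ρ : Fin k → ℕ} (hρ : IsCayley ρ) (h0 : ρ 0 = m) :
    Set.InjOn (fun s : ColouredInvSeq n => s.extend ρ) (setA n m) := by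
  intro s hs t ht h
  replace h : s.extend ρ = t.extend ρ := h
  refine ColouredInvSeq.ext (funext fun i => ?_) (funext fun v => ?_)
  · rw [← s.extend_castAdd ρ, h, t.extend_castAdd]
  · have h1 := ColouredInvSeq.available_iff hρ h0 hs v
    rw [h, ← ColouredInvSeq.available_iff hρ h0 ht v] at h1
    by_cases hb : s.colour v = Colour.blue
    · rw [hb, h1.1 hb]
    · rw [Colour.eq_red_iff.2 hb, Colour.eq_red_iff.2 fun h => hb (h1.2 h)]

open Classical in
theorem IsSuffixExtension.exists_extend {n k m : ℕ} [NeZero k] {ρ : Fin k → ℕ} (hρ : IsCayley ρ)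
    (h0 : ρ 0 = m) {σ : Fin (n + k) → ℕ} (h : IsSuffixExtension ρ σ) :
    ∃ s ∈ setA n m, s.extend ρ = σ := by
  let s : ColouredInvSeq n :=
    { val := fun i => σ (Fin.castAdd k i)
      isInvSeq := fun i => h.isInvSeq (Fin.castAdd k i)
      colour := fun v =>
        if ∃ j : Fin k, σ (Fin.natAdd n j) = (v : ℕ) then Colour.blue else Colour.red }
  have hcolour : ∀ v, s.colour v = Colour.blue ↔ ∃ j : Fin k, σ (Fin.natAdd n j) = (v : ℕ) :=
    fun v => by
      by_cases hv : ∃ j : Fin k, σ (Fin.natAdd n j) = (v : ℕ) <;> simp [s, hv]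
  have havail : ∀ (i : Fin k) (v : ℕ), v ≤ σ (Fin.natAdd n i) →
      (s.Available v ↔ ∃ j : Fin k, σ (Fin.natAdd n j) = v) := by
    intro i v hv
    rcases lt_or_ge v n with hvn | hvn
    · rw [← hcolour ⟨v, hvn⟩]
      exact ⟨fun h => h.elim (fun h => absurd hvn (not_lt.2 h)) fun ⟨_, h⟩ => h,
        fun h => Or.inr ⟨hvn, h⟩⟩
    · refine iff_of_true (Or.inl hvn) ?_
      -- The value occurs because `σ` is Cayley; being at least `n`, it must sit at a suffix
      -- position.
      obtain ⟨p, rfl⟩ := h.isCayley _ hv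
      obtain ⟨j, rfl⟩ := mem_range_natAdd.2 (hvn.trans (h.isInvSeq p))
      exact ⟨j, rfl⟩
  have hcount : ∀ i : Fin k, Nat.count s.Available (σ (Fin.natAdd n i)) = ρ i := by
    intro i
    rw [← rank_eq_of_sameOrder hρ h.sameOrder i, rank, Nat.count_eq_card_filter_range]
    congr 1
    ext v
    simp only [Finset.mem_filter, Finset.mem_range, Finset.mem_image, Finset.mem_univ, true_and,
      Function.comp_apply]
    constructor
    · rintro ⟨hv, hP⟩
      exact ⟨(havail i v hv.le).1 hP, hv⟩
    · rintro ⟨hj, hv⟩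
      exact ⟨hv, (havail i v hv.le).2 hj⟩
  have hblue : {v | s.colour v = Colour.blue}.ncard = m := by
    rw [← h0, ← hcount 0, h.start, s.count_available_of_le le_rfl]
    congr 1
    ext i
    simp
  refine ⟨s, ⟨hblue, ncard_red_of_ncard_blue hblue, fun v hv => ?_⟩, funext fun p => ?_⟩
  · have hv' := fun h => Colour.eq_red_iff.1 hv ((hcolour v).2 h)
    have hprefix : ∀ p, σ p = v → ∃ i : Fin n, Fin.castAdd k i = p := fun p hp => by
      refine ⟨⟨p, lt_of_not_ge fun hpn => ?_⟩, rfl⟩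
      obtain ⟨j, rfl⟩ := mem_range_natAdd.2 hpn
      exact hv' ⟨j, hp⟩
    obtain ⟨p, hp⟩ := h.isCayley (Fin.natAdd n 0) (a := (v : ℕ))
      (by rw [h.start]; exact v.isLt.le)
    obtain ⟨i, rfl⟩ := hprefix p hp
    obtain ⟨q, hqi, hq⟩ := h.repeated (Fin.castAdd k i) i.isLt
    obtain ⟨j, rfl⟩ := hprefix q (hq.trans hp)
    exact (Set.one_lt_ncard (Set.toFinite _)).2
      ⟨i, hp, j, hq.trans hp, fun hij => hqi (by rw [hij])⟩
  · induction p using Fin.addCases with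
    | left i => exact s.extend_castAdd ρ i
    | right i =>
      rw [s.extend_natAdd, ← hcount i]
      exact Nat.nth_count ((havail i _ le_rfl).2 ⟨i, rfl⟩)

/-! ### Enumeration and finiteness -/

theorem ncard_isMinimalFor {n k m : ℕ} [NeZero k] {ρ : Fin k → ℕ} (hρ : IsCayley ρ)
    (h0 : ρ 0 = m) (hm : ∀ i : Fin k, ρ i ≤ m + i) :
    {σ : Fin (n + k) → ℕ | IsMinimalFor ρ σ}.ncard = (setA n m).ncard := by
  have himage : {σ : Fin (n + k) → ℕ | IsMinimalFor ρ σ} =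
      (fun s : ColouredInvSeq n => s.extend ρ) '' setA n m := by
    ext σ
    rw [Set.mem_ofPred_eq, isMinimalFor_iff hρ h0 hm]
    constructor
    · intro h
      obtain ⟨s, hs, hsσ⟩ := h.exists_extend hρ h0
      exact ⟨s, hs, hsσ⟩
    · rintro ⟨s, hs, rfl⟩
      exact ColouredInvSeq.isSuffixExtension_extend hρ h0 hm hs
  rw [himage, (injOn_extend hρ h0).ncard_image]

/-- The `n - m` red values occupy at least `2 (n - m)` of the `n` positions. -/
theorem bounds_of_mem_setA {n m : ℕ} {s : ColouredInvSeq n} (hs : s ∈ setA n m) :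
    m ≤ n ∧ n ≤ 2 * m := by
  classical
  have hmn : m ≤ n := by
    rw [← hs.1]
    simpa using Set.ncard_le_card {v | s.colour v = Colour.blue}
  refine ⟨hmn, ?_⟩
  have hval : ∀ i : Fin n, s.val i < n := fun i => (s.isInvSeq i).trans_lt i.isLt
  have hred : (Finset.univ.filter fun v => s.colour v = Colour.red).card = n - m := by
    rw [← hs.2.1, ← Set.ncard_coe_finset]
    simp
  have h := Finset.card_eq_sum_card_fiberwise (s := (Finset.univ : Finset (Fin n)))
    (t := (Finset.univ : Finset (Fin n))) (f := fun i => (⟨s.val i, hval i⟩ : Fin n))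
    fun _ _ => Finset.mem_coe.2 (Finset.mem_univ _)
  have h2 := Finset.card_nsmul_le_sum (Finset.univ.filter fun v => s.colour v = Colour.red)
    (fun v => (Finset.univ.filter fun i => (⟨s.val i, hval i⟩ : Fin n) = v).card) 2 fun v hv => by
      refine (hs.2.2 v (Finset.mem_filter.1 hv).2).trans (le_of_eq ?_)
      rw [← Set.ncard_coe_finset]
      congr 1
      ext i
      simp [Fin.ext_iff]
  have h3 := h2.trans (Finset.sum_le_sum_of_subset (Finset.subset_univ _))
  rw [← h, hred, Finset.card_univ, Fintype.card_fin, smul_eq_mul] at h3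
  omega

theorem finite_and_ncard_sigma_isMinimalFor {k m : ℕ} [NeZero k] {ρ : Fin k → ℕ}
    (hρ : IsCayley ρ) (h0 : ρ 0 = m) (hm : ∀ i : Fin k, ρ i ≤ m + i) :
    {σ : (N : ℕ) × (Fin N → ℕ) | IsMinimalFor ρ σ.2}.Finite ∧
      {σ : (N : ℕ) × (Fin N → ℕ) | IsMinimalFor ρ σ.2}.ncard =
        ∑ n ∈ Finset.Icc m (2 * m), (setA n m).ncard := by
  classical
  have hfin : ∀ n, {σ : Fin (n + k) → ℕ | IsMinimalFor ρ σ}.Finite := fun n => by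
    refine (Set.Finite.pi' fun i : Fin (n + k) => Set.finite_Iic (i : ℕ)).subset ?_
    exact fun σ hσ i => hσ.1.1 i
  have hunion : {σ : (N : ℕ) × (Fin N → ℕ) | IsMinimalFor ρ σ.2} =
      ⋃ n ∈ Finset.Icc m (2 * m),
        Sigma.mk (n + k) '' {σ : Fin (n + k) → ℕ | IsMinimalFor ρ σ} := by
    ext ⟨N, σ⟩
    simp only [Set.mem_ofPred_eq, Set.mem_iUnion, Set.mem_image, exists_prop]
    constructor
    · intro h
      obtain ⟨n, rfl⟩ := Nat.exists_eq_add_of_le' h.1.2.2.length_le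
      obtain ⟨s, hs, -⟩ := ((isMinimalFor_iff hρ h0 hm).1 h).exists_extend hρ h0
      exact ⟨n, Finset.mem_Icc.2 (bounds_of_mem_setA hs), σ, h, rfl⟩
    · rintro ⟨n, -, τ, hτ, heq⟩
      cases heq
      exact hτ
  have hcoe : {σ : (N : ℕ) × (Fin N → ℕ) | IsMinimalFor ρ σ.2} =
      ((Finset.Icc m (2 * m)).biUnion fun n =>
        (hfin n).toFinset.map (Function.Embedding.sigmaMk (n + k)) :
        Finset ((N : ℕ) × (Fin N → ℕ))) := by
    rw [hunion, Finset.coe_biUnion]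
    simp
  rw [hcoe, Set.ncard_coe_finset]
  refine ⟨Finset.finite_toSet _, ?_⟩
  rw [Finset.card_biUnion]
  · refine Finset.sum_congr rfl fun n _ => ?_
    rw [Finset.card_map, ← Set.ncard_eq_toFinset_card _ (hfin n), ncard_isMinimalFor hρ h0 hm]
  · intro n _ n' _ hne
    refine Finset.disjoint_left.2 fun σ hσ hσ' => hne ?_
    obtain ⟨τ, -, rfl⟩ := Finset.mem_map.1 hσ
    obtain ⟨τ', -, heq⟩ := Finset.mem_map.1 hσ'
    exact (Nat.add_right_cancel (congrArg Sigma.fst heq)).symm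

end InvSeq

theorem mainTheorem9 :
    -- the differential equation and the initial condition; `PowerSeries.C PowerSeries.X` is `y`
    (PowerSeries.derivative ℚ⟦X⟧ InvSeq.genB =
        (PowerSeries.C PowerSeries.X + 1) *
          (PowerSeries.exp ℚ⟦X⟧).subst InvSeq.genB - InvSeq.genB - 1 ∧
      PowerSeries.constantCoeff InvSeq.genB = 0) ∧
    -- the bijection between `A_{n,m}` and `B_{n+1,m+1}`
    (∀ n m : ℕ,
      Set.BijOn InvSeq.phi (InvSeq.setA n m) (InvSeq.setB (n + 1) (m + 1))) ∧
    -- the enumeration of minimal inversion sequences, by length and in total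
    (∀ (k : ℕ) [NeZero k] (m : ℕ) (ρ : Fin k → ℕ), InvSeq.IsCayley ρ →
      (ρ 0 : ℤ) = InvSeq.mdd ρ → InvSeq.mdd ρ = (m : ℤ) →
      (∀ n : ℕ,
        {σ : Fin (n + k) → ℕ | InvSeq.IsMinimalFor ρ σ}.ncard = (InvSeq.setA n m).ncard ∧
        {σ : Fin (n + k) → ℕ | InvSeq.IsMinimalFor ρ σ}.ncard =
          (InvSeq.setB (n + 1) (m + 1)).ncard ∧
        ({σ : Fin (n + k) → ℕ | InvSeq.IsMinimalFor ρ σ}.ncard : ℚ) =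
          ((n + 1)! : ℚ) *
            PowerSeries.coeff (m + 1) (PowerSeries.coeff (n + 1) InvSeq.genB)) ∧
      {σ : (N : ℕ) × (Fin N → ℕ) | InvSeq.IsMinimalFor ρ σ.2}.Finite ∧
      {σ : (N : ℕ) × (Fin N → ℕ) | InvSeq.IsMinimalFor ρ σ.2}.ncard =
        ∑ n ∈ Finset.Icc m (2 * m), (InvSeq.setA n m).ncard) := by
  refine ⟨InvSeq.genB_differential_equation, InvSeq.bijOn_phi, fun k _ m ρ hρ hstart hmdd => ?_⟩
  have h0 : ρ 0 = m := by exact_mod_cast hstart.trans hmdd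
  have hm : ∀ i : Fin k, ρ i ≤ m + i := fun i => by
    have h := Finset.le_sup' (fun i : Fin k => (ρ i : ℤ) - ((i : ℕ) : ℤ)) (Finset.mem_univ i)
    have h' : (ρ i : ℤ) - ((i : ℕ) : ℤ) ≤ m := h.trans_eq hmdd
    omega
  refine ⟨fun n => ?_, InvSeq.finite_and_ncard_sigma_isMinimalFor hρ h0 hm⟩
  have h := InvSeq.ncard_isMinimalFor (n := n) hρ h0 hm
  refine ⟨h, h.trans (InvSeq.ncard_setA_eq_ncard_setB n m), ?_⟩
  rw [InvSeq.coeff_coeff_genB, h, InvSeq.ncard_setA_eq_ncard_setB]
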